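/- Let $r, t \ge 2$ be integers. Let $K_{t,\dots,t}$ denote the complete $r$-partite $r$-uniform hypergraph with $r$ parts of size $t$: its vertex set is the disjoint union of $r$ sets $V_1,\dots,V_r$ of size $t$, and its edges are all the sets of vertices that contain exactly one vertex from each $V_i$. Let $H_{t,\dots,t}$ be its subdivision, that is, the bipartite graph between the vertices of $K_{t,\dots,t}$ and the edges of $K_{t,\dots,t}$ in which a vertex $v$ and an edge $e$ are joined if and only if $v \in e$. For a graph $H$, let $\mathrm{ex}(n,H)$ be the largest number of edges in a simple graph on $n$ vertices that contains no (not necessarily induced) subgraph isomorphic to $H$. Then there exist constants $C > 0$ and $\delta > 0$, depending only on $r$ and $t$, such that for every natural number $n$, $$\mathrm{ex}(n, H_{t,\dots,t}) \le C\, n^{2 - 1/r - \delta}.$$ -/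

import Mathlib

namespace Hypergraph

/-- The complete `r`-partite `r`-uniform hypergraph with `r` parts of size `t`: the parts are
`{i} × Fin t` for `i : Fin r`, and the edges are all the vertex sets which contain exactly one
vertex from each part. -/
def completeMultipartite (r t : ℕ) : Hypergraph (Fin r × Fin t) where
  vertexSet := Set.univ
  edgeSet := {e | ∀ i : Fin r, ∃! v : Fin r × Fin t, v ∈ e ∧ v.1 = i}
  subset_vertexSet_of_mem_edgeSet' := fun e _ => Set.subset_univ e

/-- The subdivision of a hypergraph `H`: the bipartite graph between the vertices of `H` and the
edges of `H`, in which a vertex `v` and an edge `e` are joined if and only if `v ∈ e`. -/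
def subdivision {α : Type*} (H : Hypergraph α) : SimpleGraph (H.vertexSet ⊕ H.edgeSet) where
  Adj x y :=
    match x, y with
    | Sum.inl v, Sum.inr e => (v : α) ∈ (e : Set α)
    | Sum.inr e, Sum.inl v => (v : α) ∈ (e : Set α)
    | Sum.inl _, Sum.inl _ => False
    | Sum.inr _, Sum.inr _ => False
  symm := ⟨by
    rintro (v | e) (w | f) h
    · exact h
    · exact h
    · exact h
    · exact h⟩
  loopless := ⟨by
    rintro (v | e) h
    · exact h
    · exact h⟩

end Hypergraph

open Finset

/-! Let `G` on `n` vertices be free of the subdivision, and call an `r`-tuple light if it has fewer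
than `t ^ r + r * t` common neighbours, heavy otherwise. Were most tuples in a large neighbourhood
heavy, the Sidorenko-type count would give an injective copy of the hypergraph with all edges heavy,
and subdivision vertices could be chosen greedily. So at least half are light
(`degree_pow_le_two_mul_card_light`). A light tuple lies in boundedly many neighbourhoods, so `∑ deg
^ r` is `O(#light)`; with `#light ≤ n ^ r` this gives only the exponent `2 - 1/r`.

The gain comes from vertices of degree at most `D = n ^ (1 - η)`. Colour each light tuple by a
common neighbour among them. Every copy of the hypergraph in light tuples must be degenerate: two
vertices coincide, a vertex equals a colour, or two edges share a colour. Such copies form an `O(D /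
n)` proportion of all maps, so Sidorenko bounds `#light` by `O(n ^ (r - η / t ^ r))`
(`card_lightTuples_pow_le`), and the power mean turns this into `δ = η / (r * t ^ r)`. Vertices of
larger degree are few enough for the trivial bound on `#light`. -/

/-! ### Sidorenko-type counting. -/

/-- Power mean inequality without division. -/
theorem sum_pow_mul_card_le {ι : Type*} (s : Finset ι) (f : ι → ℝ) (hf : ∀ i ∈ s, 0 ≤ f i)
    (m : ℕ) : (∑ i ∈ s, f i) ^ m * (#s : ℝ) ≤ (#s : ℝ) ^ m * ∑ i ∈ s, f i ^ m := by
  rcases s.eq_empty_or_nonempty with rfl | hs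
  · simp
  have hs' : (0 : ℝ) < #s := by exact_mod_cast hs.card_pos
  cases m with
  | zero => simp
  | succ m =>
    have h := pow_sum_div_card_le_sum_pow (s := s) (f := f) hf m
    rw [div_le_iff₀ (by positivity)] at h
    calc _ ≤ ((∑ i ∈ s, f i ^ (m + 1)) * (#s : ℝ) ^ m) * #s := by gcongr
      _ = _ := by ring

/-- The complete `r`-partite `r`-uniform hypergraph satisfies the Sidorenko-type inequality. -/
theorem sum_pow_mul_card_pow_le_sum_prod {X : Type*} [Fintype X] [Nonempty X] (t r : ℕ)
    (w : (Fin r → X) → ℝ) (hw : ∀ x, 0 ≤ w x) :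
    (∑ x, w x) ^ (t ^ r) * (Fintype.card X : ℝ) ^ (r * t) ≤
      (Fintype.card X : ℝ) ^ (r * t ^ r) *
        ∑ x : Fin r → Fin t → X, ∏ f : Fin r → Fin t, w (fun i => x i (f i)) := by
  induction r with
  | zero => simp [Subsingleton.elim _ (default : Fin 0 → X)]
  | succ r ih =>
    set N : ℝ := (Fintype.card X : ℝ) with hN
    have hN0 : 0 < N := by simp [hN, Fintype.card_pos]
    -- Blow up the first part only: `U a` is the total of the `r`-variable weight obtained by
    -- multiplying `w` over the `t` first coordinates `a`. The power mean over `z`, then over `a`,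
    -- reduces to the induction hypothesis for that weight.
    set U : (Fin t → X) → ℝ := fun a => ∑ z : Fin r → X, ∏ j, w (Fin.cons (a j) z) with hU
    set Z : (Fin t → X) → ℝ := fun a => ∑ x : Fin r → Fin t → X, ∏ f : Fin r → Fin t,
      ∏ j, w (Fin.cons (a j) (fun i => x i (f i))) with hZ
    have hU0 : ∀ a, 0 ≤ U a := fun a => sum_nonneg fun z _ => prod_nonneg fun j _ => hw _
    have hZ' : ∑ x : Fin (r + 1) → Fin t → X, ∏ f : Fin (r + 1) → Fin t, w (fun i => x i (f i))
        = ∑ a, Z a := by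
      rw [← (Fin.consEquiv fun _ => Fin t → X).sum_comp, Fintype.sum_prod_type]
      refine sum_congr rfl fun a _ => sum_congr rfl fun x _ => ?_
      rw [← (Fin.consEquiv fun _ => Fin t).prod_comp, Fintype.prod_prod_type, prod_comm]
      refine prod_congr rfl fun f _ => prod_congr rfl fun j _ => congrArg w ?_
      funext i
      refine Fin.cases ?_ (fun i => ?_) i <;> simp [Fin.consEquiv]
    have hW : (∑ x, w x) ^ t * N ^ r ≤ N ^ (r * t) * ∑ a, U a := by
      have h := sum_pow_mul_card_le (univ : Finset (Fin r → X))
        (fun z => ∑ a, w (Fin.cons a z)) (fun z _ => sum_nonneg fun a _ => hw _) t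
      have h1 : ∑ z : Fin r → X, ∑ a, w (Fin.cons a z) = ∑ x, w x := by
        rw [← (Fin.consEquiv fun _ => X).sum_comp, Fintype.sum_prod_type, sum_comm]
        rfl
      have h2 : ∑ z : Fin r → X, (∑ a, w (Fin.cons a z)) ^ t = ∑ a, U a := by
        rw [hU, sum_comm]
        refine sum_congr rfl fun z _ => ?_
        rw [Fintype.sum_pow]
      rw [h1, h2] at h
      simpa [hN, pow_mul] using h
    have hUU := sum_pow_mul_card_le (univ : Finset (Fin t → X)) U (fun a _ => hU0 a) (t ^ r)
    have hUU' : (∑ a, U a) ^ t ^ r * N ^ t ≤ N ^ (t * t ^ r) * ∑ a, U a ^ t ^ r := by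
      simpa [hN, pow_mul] using hUU
    have hI : (∑ a, U a ^ t ^ r) * N ^ (r * t) ≤ N ^ (r * t ^ r) * ∑ a, Z a := by
      rw [sum_mul, mul_sum]
      exact sum_le_sum fun a _ => ih (fun z => ∏ j, w (Fin.cons (a j) z))
        fun z => prod_nonneg fun j _ => hw _
    rw [hZ']
    have hS : 0 ≤ ∑ x, w x := sum_nonneg fun x _ => hw x
    refine le_of_mul_le_mul_right ?_ (pow_pos hN0 (r * t ^ r))
    calc (∑ x, w x) ^ t ^ (r + 1) * N ^ ((r + 1) * t) * N ^ (r * t ^ r)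
        = ((∑ x, w x) ^ t * N ^ r) ^ t ^ r * N ^ t * N ^ (r * t) := by
          rw [mul_pow, ← pow_mul, ← pow_mul, pow_succ' t r, add_mul, pow_add]; ring
      _ ≤ (N ^ (r * t) * ∑ a, U a) ^ t ^ r * N ^ t * N ^ (r * t) := by gcongr
      _ = (N ^ (r * t)) ^ t ^ r * N ^ (r * t) * ((∑ a, U a) ^ t ^ r * N ^ t) := by
          rw [mul_pow]; ring
      _ ≤ (N ^ (r * t)) ^ t ^ r * N ^ (r * t) * (N ^ (t * t ^ r) * ∑ a, U a ^ t ^ r) := by gcongr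
      _ = (N ^ (r * t)) ^ t ^ r * N ^ (t * t ^ r) * ((∑ a, U a ^ t ^ r) * N ^ (r * t)) := by ring
      _ ≤ (N ^ (r * t)) ^ t ^ r * N ^ (t * t ^ r) * (N ^ (r * t ^ r) * ∑ a, Z a) := by gcongr
      _ = N ^ ((r + 1) * t ^ (r + 1)) * (∑ a, Z a) * N ^ (r * t ^ r) := by
          rw [← pow_mul, pow_succ' t r, add_mul, pow_add, one_mul, mul_assoc r t]; ring

/-- The edge through the `f i`-th vertex of the `i`-th part, for each `i`. -/
def transversal {X : Type*} {r t : ℕ} (x : Fin r × Fin t → X) (f : Fin r → Fin t) : Fin r → X :=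
  fun i => x (i, f i)

/-- The number of homomorphic copies of the complete `r`-partite hypergraph with parts of size `t`
in a family `S` of `r`-tuples is at least what is expected from the density of `S`. -/
theorem card_pow_mul_card_pow_le {X : Type*} [Fintype X] [Nonempty X] {t r : ℕ}
    (S : Set (Fin r → X)) [DecidablePred (· ∈ S)] :
    (#{z | z ∈ S} : ℝ) ^ (t ^ r) * (Fintype.card X : ℝ) ^ (r * t) ≤
      (Fintype.card X : ℝ) ^ (r * t ^ r) *
        #{x : Fin r × Fin t → X | ∀ f, transversal x f ∈ S} := by
  have h := sum_pow_mul_card_pow_le_sum_prod t r (fun z => if z ∈ S then (1 : ℝ) else 0)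
    (fun z => by split_ifs <;> norm_num)
  rw [← (Equiv.curry (Fin r) (Fin t) X).sum_comp] at h
  simp only [prod_boole, Finset.sum_boole, mem_univ, true_imp_iff] at h
  exact h

/-! ### Counting degenerate maps. -/

/-- If a coordinate of `x` is a function of the others, this saves one factor in the count. -/
theorem card_filter_apply_eq_mul_le {P X : Type*} [Fintype P] [DecidableEq P] [Fintype X]
    [DecidableEq X] (p : P) (F : (P → X) → X)
    (hF : ∀ x y, (∀ q, q ≠ p → x q = y q) → F x = F y) :
    #{x : P → X | x p = F x} * Fintype.card X ≤ Fintype.card X ^ Fintype.card P := by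
  have h : #{x : P → X | x p = F x} ≤ Fintype.card ({q // q ≠ p} → X) := by
    refine card_le_card_of_injOn (t := univ) (fun x q => x q) (by simp) ?_
    intro x hx y hy hxy
    simp only [coe_filter, mem_univ, true_and, Set.mem_ofPred_eq] at hx hy
    have h : ∀ q, q ≠ p → x q = y q := fun q hq => congrFun hxy ⟨q, hq⟩
    funext q
    by_cases hq : q = p
    · rw [hq, hx, hy, hF x y h]
    · exact h q hq
  have hp : 0 < Fintype.card P := Fintype.card_pos_iff.2 ⟨p⟩
  calc _ ≤ Fintype.card ({q // q ≠ p} → X) * Fintype.card X := by gcongr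
    _ = _ := by
      rw [Fintype.card_fun, Fintype.card_subtype_compl, Fintype.card_subtype_eq, ← pow_succ,
        Nat.sub_add_cancel hp]

theorem card_not_injective_mul_le {P X : Type*} [Fintype P] [DecidableEq P] [Fintype X]
    [DecidableEq X] :
    #{x : P → X | ¬ Function.Injective x} * Fintype.card X ≤
      Fintype.card P ^ 2 * Fintype.card X ^ Fintype.card P := by
  have h : ({x : P → X | ¬ Function.Injective x} : Finset (P → X)) ⊆
      (univ : Finset P).offDiag.biUnion fun p => {x : P → X | x p.1 = x p.2} := by
    intro x hx
    simp only [mem_filter, mem_univ, true_and, Function.Injective, not_forall] at hx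
    obtain ⟨p, q, hpq, hne⟩ := hx
    simpa using ⟨p, q, hne, hpq⟩
  calc _ ≤ (∑ p ∈ (univ : Finset P).offDiag, #{x : P → X | x p.1 = x p.2}) * Fintype.card X := by
        gcongr
        exact (card_le_card h).trans card_biUnion_le
    _ ≤ ∑ p ∈ (univ : Finset P).offDiag, Fintype.card X ^ Fintype.card P := by
        rw [sum_mul]
        refine sum_le_sum fun p hp => card_filter_apply_eq_mul_le p.1 (fun x => x p.2) ?_
        intro x y h
        exact h _ (by simpa [eq_comm] using hp)
    _ ≤ _ := by
        rw [sum_const, smul_eq_mul, offDiag_card, card_univ, sq]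
        gcongr
        exact Nat.sub_le _ _

/-! ### Assembling a copy of the subdivision. -/

section Embedding

variable {V : Type*} {G : SimpleGraph V} {r t : ℕ}

/-- A copy of the subdivision of the complete multipartite hypergraph is given by its vertices `x`
and its subdivision vertices `y`, indexed by transversals. -/
theorem subdivision_isContained (x : Fin r × Fin t → V) (y : (Fin r → Fin t) → V)
    (hx : Function.Injective x) (hy : Function.Injective y) (hxy : ∀ p f, x p ≠ y f)
    (hadj : ∀ f i, G.Adj (transversal x f i) (y f)) :
    (Hypergraph.completeMultipartite r t).subdivision.IsContained G := by
  have key : ∀ e : (Hypergraph.completeMultipartite r t).edgeSet,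
      ∃ f : Fin r → Fin t, ∀ v, v ∈ e.1 ↔ v.2 = f v.1 := by
    rintro ⟨e, he⟩
    have he' : ∀ i : Fin r, ∃! v : Fin r × Fin t, v ∈ e ∧ v.1 = i := he
    choose v hv hu using he'
    refine ⟨fun i => (v i).2, fun w => ⟨fun hw => ?_, fun hw => ?_⟩⟩
    · exact congrArg Prod.snd (hu w.1 w ⟨hw, rfl⟩)
    · have : w = v w.1 := Prod.ext (hv w.1).2.symm hw
      rw [this]
      exact (hv w.1).1
  choose f hf using key
  have hf_inj : Function.Injective f := fun e e' h =>
    Subtype.ext (Set.ext fun v => by rw [hf, hf, h])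
  have hmem : ∀ (v : (Hypergraph.completeMultipartite r t).vertexSet)
      (e : (Hypergraph.completeMultipartite r t).edgeSet), v.1 ∈ e.1 → G.Adj (x v.1) (y (f e)) := by
    intro v e h
    have := hadj (f e) v.1.1
    rwa [transversal, ← (hf e v.1).1 h] at this
  refine ⟨⟨⟨Sum.elim (fun v => x v.1) (fun e => y (f e)), ?_⟩, ?_⟩⟩
  · rintro (v | e) (w | e') h
    · exact h.elim
    · exact hmem v e' h
    · exact (hmem w e h).symm
    · exact h.elim
  · exact Function.Injective.sumElim (hx.comp Subtype.val_injective) (hy.comp hf_inj)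
      fun v e => hxy v.1 (f e)

end Embedding

/-! ### Common neighbourhoods and light tuples. -/

section Counting

variable {V : Type*} [Fintype V] [DecidableEq V] (G : SimpleGraph V) [DecidableRel G.Adj] {r t : ℕ}

/-- The common neighbours of the entries of a tuple. -/
def commonNbrs (z : Fin r → V) : Finset V := {b | ∀ i, G.Adj (z i) b}

variable {G}

omit [DecidableEq V] in
theorem mem_commonNbrs {z : Fin r → V} {b : V} : b ∈ commonNbrs G z ↔ ∀ i, G.Adj (z i) b := by
  simp [commonNbrs]

/-- If all transversals of `x` have many common neighbours then the subdivision vertices can be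
chosen greedily. -/
theorem subdivision_isContained_of_card_le (x : Fin r × Fin t → V) (hx : Function.Injective x)
    (h : ∀ f, t ^ r + r * t ≤ #(commonNbrs G (transversal x f))) :
    (Hypergraph.completeMultipartite r t).subdivision.IsContained G := by
  have hcard : ∀ f, t ^ r ≤ #(commonNbrs G (transversal x f) \ univ.image x) := by
    intro f
    have h1 := le_card_sdiff (univ.image x) (commonNbrs G (transversal x f))
    have h2 : #(univ.image x) ≤ r * t := card_image_le.trans (by simp)
    have h3 := h f
    omega
  -- Hall's condition is immediate: each set of candidates alone has at least as many elements as
  -- there are transversals.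
  obtain ⟨y, hy, hy'⟩ := (all_card_le_biUnion_card_iff_exists_injective
    (fun f : Fin r → Fin t => commonNbrs G (transversal x f) \ univ.image x)).1 (by
      intro s
      rcases s.eq_empty_or_nonempty with rfl | ⟨f, hf⟩
      · simp
      calc #s ≤ t ^ r := by simpa using card_le_univ s
        _ ≤ _ := hcard f
        _ ≤ _ := card_le_card (subset_biUnion_of_mem
            (fun f : Fin r → Fin t => commonNbrs G (transversal x f) \ univ.image x) hf))
  refine subdivision_isContained x y hx hy (fun p f hpf => ?_) fun f => ?_
  · exact (mem_sdiff.1 (hy' f)).2 (hpf ▸ mem_image_of_mem x (mem_univ p))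
  · exact mem_commonNbrs.1 (mem_sdiff.1 (hy' f)).1

/-- In a graph without the subdivision, at least half of the tuples in a large neighbourhood have
few common neighbours. -/
theorem degree_pow_le_two_mul_card_light
    (hG : (Hypergraph.completeMultipartite r t).subdivision.Free G) (b : V)
    (hb : 2 ^ t ^ r * (r * t) ^ 2 < G.degree b) :
    G.degree b ^ r ≤ 2 * #{z ∈ Fintype.piFinset fun _ : Fin r => G.neighborFinset b |
      #(commonNbrs G z) < t ^ r + r * t} := by
  set L := #{z ∈ Fintype.piFinset fun _ : Fin r => G.neighborFinset b |
      #(commonNbrs G z) < t ^ r + r * t} with hL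
  set N := G.degree b with hN
  have hN0 : 0 < N := by omega
  have hX : Fintype.card (G.neighborSet b) = N := G.card_neighborSet_eq_degree b
  have : Nonempty (G.neighborSet b) := Fintype.card_pos_iff.1 (by omega)
  set S : Set (Fin r → G.neighborSet b) :=
    {z | t ^ r + r * t ≤ #(commonNbrs G fun i => (z i : V))} with hS
  classical
  have hsplit : N ^ r ≤ #{z | z ∈ S} + L := by
    have h1 := card_filter_add_card_filter_not (s := (univ : Finset (Fin r → G.neighborSet b)))
      (· ∈ S)
    rw [card_univ, Fintype.card_fun, hX, Fintype.card_fin] at h1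
    rw [← h1]
    gcongr
    refine card_le_card_of_injOn (fun z i => (z i : V)) ?_ ?_
    · intro z hz
      have hz' : ¬ z ∈ S := by simpa using hz
      simp only [coe_filter, Fintype.mem_piFinset, SimpleGraph.mem_neighborFinset,
        Set.mem_ofPred_eq]
      exact ⟨fun i => (z i).2, not_le.1 hz'⟩
    · intro z _ z' _ h
      funext i
      exact Subtype.ext (congrFun h i)
  by_contra! hlt
  have hK : N ^ r ≤ 2 * #{z | z ∈ S} := by omega
  have hsid : #{z | z ∈ S} ^ t ^ r * N ^ (r * t) ≤ N ^ (r * t ^ r) *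
      #{x : Fin r × Fin t → G.neighborSet b | ∀ f, transversal x f ∈ S} := by
    have := card_pow_mul_card_pow_le (t := t) S
    rw [hX] at this
    exact_mod_cast this
  -- Non-injective maps have proportion at most `(r * t) ^ 2 / N`, while heavy density at least
  -- `1/2` forces proportion at least `1 / 2 ^ t ^ r`; the degree threshold makes these
  -- incompatible.
  have hsub : #{x : Fin r × Fin t → G.neighborSet b | ∀ f, transversal x f ∈ S} ≤
      #{x : Fin r × Fin t → G.neighborSet b | ¬ Function.Injective x} := by
    refine card_le_card fun x hx => ?_
    simp only [mem_filter, mem_univ, true_and] at hx ⊢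
    intro hinj
    exact hG (subdivision_isContained_of_card_le (fun p => (x p : V))
      (Subtype.val_injective.comp hinj) hx)
  have hinj := card_not_injective_mul_le (P := Fin r × Fin t) (X := G.neighborSet b)
  rw [hX, Fintype.card_prod, Fintype.card_fin, Fintype.card_fin] at hinj
  set A := #{x : Fin r × Fin t → G.neighborSet b | ¬ Function.Injective x}
  set B := #{x : Fin r × Fin t → G.neighborSet b | ∀ f, transversal x f ∈ S}
  set K := #{z | z ∈ S}
  refine absurd ?_ (not_le.2 hb)
  refine Nat.le_of_mul_le_mul_left ?_ (show 0 < N ^ (r * t ^ r) * N ^ (r * t) by positivity)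
  calc N ^ (r * t ^ r) * N ^ (r * t) * N = (N ^ r) ^ t ^ r * N ^ (r * t) * N := by rw [pow_mul]
    _ ≤ (2 * K) ^ t ^ r * N ^ (r * t) * N := by gcongr
    _ = 2 ^ t ^ r * (K ^ t ^ r * N ^ (r * t)) * N := by rw [mul_pow]; ring
    _ ≤ 2 ^ t ^ r * (N ^ (r * t ^ r) * A) * N := by gcongr 2 ^ t ^ r * ?_ * N; exact hsid.trans (by gcongr)
    _ = 2 ^ t ^ r * N ^ (r * t ^ r) * (A * N) := by ring
    _ ≤ 2 ^ t ^ r * N ^ (r * t ^ r) * ((r * t) ^ 2 * N ^ (r * t)) := by gcongr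
    _ = _ := by ring

variable (G t) in
/-- The tuples with few common neighbours, one of which lies in `B`. -/
def lightTuples (r : ℕ) (B : Finset V) : Finset (Fin r → V) :=
  {z | #(commonNbrs G z) < t ^ r + r * t ∧ ∃ b ∈ B, ∀ i, G.Adj (z i) b}

/-- Double count pairs of a vertex of `B` and a light tuple in its neighbourhood: half of each `deg
^ r` is light, and lightness bounds how often a tuple recurs. -/
theorem sum_degree_pow_le_card_lightTuples
    (hG : (Hypergraph.completeMultipartite r t).subdivision.Free G) (B : Finset V)
    (hB : ∀ b ∈ B, 2 ^ t ^ r * (r * t) ^ 2 < G.degree b) :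
    ∑ b ∈ B, G.degree b ^ r ≤ 2 * (t ^ r + r * t) * #(lightTuples G t r B) := by
  set R : V → (Fin r → V) → Prop := fun b z => ∀ i, G.Adj (z i) b with hR
  calc ∑ b ∈ B, G.degree b ^ r
      ≤ ∑ b ∈ B, 2 * #((lightTuples G t r B).bipartiteAbove R b) := by
        refine sum_le_sum fun b hb => (degree_pow_le_two_mul_card_light hG b (hB b hb)).trans ?_
        gcongr
        intro z hz
        simp only [mem_filter, Fintype.mem_piFinset, SimpleGraph.mem_neighborFinset] at hz
        have hz1 : ∀ i, G.Adj (z i) b := fun i => (hz.1 i).symm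
        simp only [bipartiteAbove, lightTuples, mem_filter, mem_univ, true_and]
        exact ⟨⟨hz.2, b, hb, hz1⟩, hz1⟩
    _ = 2 * ∑ z ∈ lightTuples G t r B, #(B.bipartiteBelow R z) := by
        rw [← mul_sum, sum_card_bipartiteAbove_eq_sum_card_bipartiteBelow]
    _ ≤ 2 * ∑ z ∈ lightTuples G t r B, (t ^ r + r * t) := by
        gcongr with z hz
        simp only [lightTuples, mem_filter, mem_univ, true_and] at hz
        refine le_trans (card_le_card fun b hb => ?_) hz.1.le
        exact mem_commonNbrs.2 (mem_filter.1 hb).2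
    _ = _ := by rw [sum_const, smul_eq_mul]; ring

omit [DecidableEq V] in
theorem card_lightTuples_le (B : Finset V) :
    #(lightTuples G t r B) ≤ Fintype.card V ^ r := by
  simpa using card_le_univ (lightTuples G t r B)

omit [DecidableEq V] in
/-- The number of maps `P → V` sending all of `Q` into the neighbourhood of `b`. -/
theorem card_forall_adj_mul {P : Type*} [Fintype P] [DecidableEq P] (Q : Finset P) (b : V) :
    #{x : P → V | ∀ q ∈ Q, G.Adj (x q) b} * Fintype.card V ^ #Q =
      G.degree b ^ #Q * Fintype.card V ^ Fintype.card P := by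
  have h : ({x : P → V | ∀ q ∈ Q, G.Adj (x q) b} : Finset (P → V)) =
      Fintype.piFinset fun q => if q ∈ Q then G.neighborFinset b else univ := by
    ext x
    simp only [mem_filter, mem_univ, true_and, Fintype.mem_piFinset]
    refine forall_congr' fun q => ?_
    by_cases hq : q ∈ Q <;> simp [hq, G.adj_comm]
  have h2 : ∀ q, #(if q ∈ Q then G.neighborFinset b else univ) =
      if q ∈ Q then G.degree b else Fintype.card V := by
    intro q; split_ifs <;> simp
  have h3 := card_filter_add_card_filter_not (s := (univ : Finset P)) (· ∈ Q)
  rw [h, Fintype.card_piFinset, prod_congr rfl fun q _ => h2 q, prod_ite, prod_const, prod_const,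
    ← card_univ (α := P), ← h3, filter_mem_eq_inter, univ_inter, pow_add]
  ring

/-- If the transversals of `x` are coloured by their common neighbours in `B`, then few `x` have
two transversals of the same colour. -/
theorem card_same_color_mul_le (B : Finset V) (D : ℕ) (hD : ∀ b ∈ B, G.degree b ≤ D)
    (c : (Fin r → V) → V) {f g : Fin r → Fin t} (hfg : f ≠ g) :
    #{x : Fin r × Fin t → V | (∀ f, c (transversal x f) ∈ B ∧
        ∀ i, G.Adj (transversal x f i) (c (transversal x f))) ∧
        c (transversal x f) = c (transversal x g)} * Fintype.card V ^ (r + 1) ≤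
      Fintype.card V ^ (r * t) * (D * ∑ b ∈ B, G.degree b ^ r) := by
  obtain ⟨i₀, hi₀⟩ := Function.ne_iff.1 hfg
  set Q : Finset (Fin r × Fin t) := insert (i₀, g i₀) (univ.image fun i => (i, f i)) with hQ
  -- Distinct transversals differ in some part, so a shared colour is adjacent to at least `r + 1`
  -- entries of `x`. The extra entry yields the factor `D / n`.
  have hQcard : #Q = r + 1 := by
    rw [hQ, card_insert_of_notMem, card_image_of_injective, card_univ, Fintype.card_fin]
    · intro i j h; exact (Prod.ext_iff.1 h).1
    · simp only [mem_image, mem_univ, true_and, not_exists, Prod.mk.injEq, not_and]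
      rintro i rfl; exact hi₀
  calc _ ≤ (∑ b ∈ B, #{x : Fin r × Fin t → V | ∀ q ∈ Q, G.Adj (x q) b}) *
        Fintype.card V ^ (r + 1) := by
        gcongr
        refine (card_le_card fun x hx => ?_).trans card_biUnion_le
        simp only [mem_filter, mem_univ, true_and] at hx
        obtain ⟨hx, heq⟩ := hx
        simp only [mem_biUnion, mem_filter, mem_univ, true_and]
        refine ⟨c (transversal x f), (hx f).1, fun q hq => ?_⟩
        rw [hQ, mem_insert, mem_image] at hq
        rcases hq with rfl | ⟨i, -, rfl⟩
        · rw [heq]; exact (hx g).2 i₀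
        · exact (hx f).2 i
    _ = ∑ b ∈ B, G.degree b ^ (r + 1) * Fintype.card V ^ (r * t) := by
        rw [sum_mul]
        refine sum_congr rfl fun b _ => ?_
        rw [← hQcard, card_forall_adj_mul, Fintype.card_prod, Fintype.card_fin, Fintype.card_fin]
    _ ≤ ∑ b ∈ B, (D * G.degree b ^ r) * Fintype.card V ^ (r * t) := by
        refine sum_le_sum fun b hb => ?_
        rw [pow_succ']
        gcongr
        exact hD b hb
    _ = _ := by rw [← sum_mul, ← mul_sum, mul_comm]

/-- Copies of the hypergraph in light tuples are all degenerate, in one of the three ways `E₁`,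
`E₂`, `E₃`; the Sidorenko-type lower bound on their number then limits the light tuples themselves.
-/
theorem card_lightTuples_pow_le [Nonempty V]
    (hG : (Hypergraph.completeMultipartite r t).subdivision.Free G) (B : Finset V) (D : ℕ)
    (hD1 : 1 ≤ D) (hB : ∀ b ∈ B, 2 ^ t ^ r * (r * t) ^ 2 < G.degree b)
    (hD : ∀ b ∈ B, G.degree b ≤ D) :
    #(lightTuples G t r B) ^ t ^ r * Fintype.card V ≤
      ((r * t) ^ 2 + r * t * t ^ r + 2 * (t ^ r + r * t) * (t ^ r) ^ 2) * D *
        Fintype.card V ^ (r * t ^ r) := by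
  set n := Fintype.card V with hn
  have hn0 : 0 < n := Fintype.card_pos
  have hc : ∀ z : Fin r → V, ∃ b, z ∈ lightTuples G t r B → b ∈ B ∧ ∀ i, G.Adj (z i) b := by
    intro z
    by_cases hz : z ∈ lightTuples G t r B
    · obtain ⟨b, hb⟩ := (mem_filter.1 hz).2.2
      exact ⟨b, fun _ => hb⟩
    · exact ⟨Classical.arbitrary V, fun h => absurd h hz⟩
  choose c hc using hc
  set E₁ : Finset (Fin r × Fin t → V) := {x | ¬ Function.Injective x}
  set E₂ : (Fin r × Fin t) × (Fin r → Fin t) → Finset (Fin r × Fin t → V) := fun pf =>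
    {x | x pf.1 = c (transversal x pf.2)} with hE₂
  set E₃ : (Fin r → Fin t) × (Fin r → Fin t) → Finset (Fin r × Fin t → V) := fun fg =>
    {x | (∀ f, c (transversal x f) ∈ B ∧
        ∀ i, G.Adj (transversal x f i) (c (transversal x f))) ∧
        c (transversal x fg.1) = c (transversal x fg.2)} with hE₃
  -- Only vertices off the transversal matter, since those on it are adjacent to its colour. Hence
  -- the colour does not depend on that coordinate of `x`.
  set I₂ : Finset ((Fin r × Fin t) × (Fin r → Fin t)) := {pf | pf.2 pf.1.1 ≠ pf.1.2} with hI₂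
  set I₃ : Finset ((Fin r → Fin t) × (Fin r → Fin t)) := univ.offDiag with hI₃
  set H : Finset (Fin r × Fin t → V) := {x | ∀ f, transversal x f ∈ lightTuples G t r B} with hH
  have hsub : H ⊆ E₁ ∪ (I₂.biUnion E₂ ∪ I₃.biUnion E₃) := by
    intro x hx
    by_contra hbad
    simp only [hH, mem_filter, mem_univ, true_and] at hx
    have hcx := fun f => hc _ (hx f)
    simp only [mem_union, mem_biUnion, not_or, not_exists, not_and] at hbad
    obtain ⟨h1, h2, h3⟩ := hbad
    refine hG (subdivision_isContained x (fun f => c (transversal x f)) ?_ ?_ ?_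
      fun f => (hcx f).2)
    · by_contra hinj
      exact h1 (by simpa [E₁] using hinj)
    · intro f g hfg
      by_contra hne
      exact h3 (f, g) (by simpa [hI₃] using hne) (by simpa [hE₃] using ⟨hcx, hfg⟩)
    · intro p f hpf
      by_cases hp : f p.1 = p.2
      · have := (hcx f).2 p.1
        simp only [transversal, hp] at this
        exact G.ne_of_adj this hpf
      · exact h2 (p, f) (by simpa [hI₂] using hp) (by simpa [hE₂] using hpf)
  have hcE₁ : #E₁ * n ≤ (r * t) ^ 2 * n ^ (r * t) := by
    simpa using card_not_injective_mul_le (P := Fin r × Fin t) (X := V)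
  have hcE₂ : ∀ pf ∈ I₂, #(E₂ pf) * n ≤ n ^ (r * t) := by
    intro pf hpf
    have := card_filter_apply_eq_mul_le (X := V) pf.1 (fun x => c (transversal x pf.2)) (by
      intro x y h
      refine congrArg c (funext fun i => h _ ?_)
      rintro heq
      refine (mem_filter.1 hpf).2 ?_
      rw [← heq])
    simpa using this
  have hcE₃ : ∀ fg ∈ I₃, #(E₃ fg) * n ≤ 2 * (t ^ r + r * t) * D * n ^ (r * t) := by
    intro fg hfg
    have h := card_same_color_mul_le B D hD c (show fg.1 ≠ fg.2 by simpa [hI₃] using hfg)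
    have h' : ∑ b ∈ B, G.degree b ^ r ≤ 2 * (t ^ r + r * t) * n ^ r :=
      (sum_degree_pow_le_card_lightTuples hG B hB).trans (by gcongr; exact card_lightTuples_le B)
    refine Nat.le_of_mul_le_mul_right ?_ (pow_pos hn0 r)
    calc #(E₃ fg) * n * n ^ r = #(E₃ fg) * n ^ (r + 1) := by ring
      _ ≤ _ := h
      _ ≤ n ^ (r * t) * (D * (2 * (t ^ r + r * t) * n ^ r)) := by gcongr
      _ = _ := by ring
  have hI₂card : #I₂ ≤ r * t * t ^ r := by simpa using card_le_univ I₂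
  have hI₃card : #I₃ ≤ (t ^ r) ^ 2 := by simpa [sq] using card_le_univ I₃
  have hHcard : #H * n ≤ ((r * t) ^ 2 + r * t * t ^ r + 2 * (t ^ r + r * t) * (t ^ r) ^ 2) * D *
      n ^ (r * t) := by
    calc #H * n ≤ (#E₁ + (∑ p ∈ I₂, #(E₂ p) + ∑ p ∈ I₃, #(E₃ p))) * n := by
          gcongr
          exact (card_le_card hsub).trans <| (card_union_le _ _).trans <| by
            gcongr
            exact (card_union_le _ _).trans (add_le_add card_biUnion_le card_biUnion_le)
      _ = #E₁ * n + (∑ p ∈ I₂, #(E₂ p) * n + ∑ p ∈ I₃, #(E₃ p) * n) := by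
          rw [add_mul, add_mul, sum_mul, sum_mul]
      _ ≤ (r * t) ^ 2 * n ^ (r * t) + (#I₂ * n ^ (r * t) +
            #I₃ * (2 * (t ^ r + r * t) * D * n ^ (r * t))) := by
          gcongr
          · exact sum_le_card_nsmul _ _ _ hcE₂
          · exact sum_le_card_nsmul _ _ _ hcE₃
      _ ≤ (r * t) ^ 2 * (D * n ^ (r * t)) + (r * t * t ^ r * (D * n ^ (r * t)) +
            (t ^ r) ^ 2 * (2 * (t ^ r + r * t) * D * n ^ (r * t))) := by
          have : n ^ (r * t) ≤ D * n ^ (r * t) := Nat.le_mul_of_pos_left _ hD1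
          gcongr
      _ = _ := by ring
  have hsid : #(lightTuples G t r B) ^ t ^ r * n ^ (r * t) ≤ n ^ (r * t ^ r) * #H := by
    have := card_pow_mul_card_pow_le (t := t) (X := V) {z | z ∈ lightTuples G t r B}
    simp only [Set.mem_ofPred_eq, filter_mem_eq_inter, univ_inter] at this
    exact_mod_cast this
  refine Nat.le_of_mul_le_mul_right ?_ (pow_pos hn0 (r * t))
  calc #(lightTuples G t r B) ^ t ^ r * n * n ^ (r * t)
      = #(lightTuples G t r B) ^ t ^ r * n ^ (r * t) * n := by ring
    _ ≤ n ^ (r * t ^ r) * #H * n := by gcongr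
    _ = n ^ (r * t ^ r) * (#H * n) := by ring
    _ ≤ n ^ (r * t ^ r) * (((r * t) ^ 2 + r * t * t ^ r + 2 * (t ^ r + r * t) * (t ^ r) ^ 2) * D *
      n ^ (r * t)) := by gcongr
    _ = _ := by ring

end Counting

/-! ### Degree sums by range of degree. -/

section Exponents

variable {V : Type*} [Fintype V] [DecidableEq V] [Nonempty V] {G : SimpleGraph V}
  [DecidableRel G.Adj] {r t : ℕ}

/-- Vertices of degree close to the number of vertices contribute few edges. -/
theorem sum_degree_le_of_large (hr : 1 ≤ r)
    (hG : (Hypergraph.completeMultipartite r t).subdivision.Free G) (B : Finset V)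
    (hB : ∀ b ∈ B, 2 ^ t ^ r * (r * t) ^ 2 < G.degree b)
    (hD : ∀ b ∈ B, (Fintype.card V : ℝ) ^ (1 - 1 / (4 * r : ℝ)) ≤ G.degree b) :
    ∑ b ∈ B, (G.degree b : ℝ) ≤
      2 * (t ^ r + r * t) * (Fintype.card V : ℝ) ^ (5 / 4 : ℝ) := by
  obtain ⟨k, rfl⟩ : ∃ k, r = k + 1 := ⟨r - 1, by omega⟩
  set n : ℝ := (Fintype.card V : ℝ) with hn
  have hn1 : 1 ≤ n := by rw [hn]; exact_mod_cast Fintype.card_pos (α := V)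
  have hn0 : 0 < n := by linarith
  set d : ℝ := n ^ (1 - 1 / (4 * (k + 1 : ℕ) : ℝ)) with hd
  have hd0 : 0 < d := Real.rpow_pos_of_pos hn0 _
  have hsum : ∑ b ∈ B, (G.degree b : ℝ) ^ (k + 1) ≤
      2 * (t ^ (k + 1) + (k + 1 : ℕ) * t) * n ^ (k + 1) := by
    have := (sum_degree_pow_le_card_lightTuples hG B hB).trans
      (Nat.mul_le_mul_left _ (card_lightTuples_le B))
    rw [hn]
    exact_mod_cast this
  -- Dividing `∑ deg ^ r` by `d ^ (r - 1)` leaves `n ^ (1 + (r - 1) / (4 * r))`, below `n ^ (5 /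
  -- 4)`.
  have hdn : n ^ (k + 1) ≤ d ^ k * n ^ (5 / 4 : ℝ) := by
    rw [hd, ← Real.rpow_mul_natCast hn0.le, ← Real.rpow_add hn0, ← Real.rpow_natCast]
    refine Real.rpow_le_rpow_of_exponent_le hn1 ?_
    have : (1 / (4 * (k + 1 : ℕ)) : ℝ) * k ≤ 1 / 4 := by
      rw [div_mul_eq_mul_div, div_le_div_iff₀ (by positivity) (by norm_num)]
      push_cast
      linarith
    rw [sub_mul]
    push_cast at this ⊢
    linarith
  refine le_of_mul_le_mul_right ?_ (pow_pos hn0 (k + 1))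
  calc (∑ b ∈ B, (G.degree b : ℝ)) * n ^ (k + 1)
      ≤ (∑ b ∈ B, (G.degree b : ℝ)) * (d ^ k * n ^ (5 / 4 : ℝ)) := by gcongr
    _ = (∑ b ∈ B, d ^ k * (G.degree b : ℝ)) * n ^ (5 / 4 : ℝ) := by rw [← mul_sum]; ring
    _ ≤ (∑ b ∈ B, (G.degree b : ℝ) ^ (k + 1)) * n ^ (5 / 4 : ℝ) := by
        gcongr with b hb
        rw [pow_succ]
        gcongr
        exact hD b hb
    _ ≤ 2 * (t ^ (k + 1) + (k + 1 : ℕ) * t) * n ^ (k + 1) * n ^ (5 / 4 : ℝ) := by gcongr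
    _ = _ := by ring

/-- Vertices of moderate degree contribute few edges. -/
theorem sum_degree_le_of_moderate (hr : 1 ≤ r) (ht : 1 ≤ t)
    (hG : (Hypergraph.completeMultipartite r t).subdivision.Free G) (B : Finset V)
    (hB : ∀ b ∈ B, 2 ^ t ^ r * (r * t) ^ 2 < G.degree b)
    (hD : ∀ b ∈ B, (G.degree b : ℝ) ≤ (Fintype.card V : ℝ) ^ (1 - 1 / (4 * r : ℝ))) :
    ∑ b ∈ B, (G.degree b : ℝ) ≤ 2 * (t ^ r + r * t) *
      ((r * t) ^ 2 + r * t * t ^ r + 2 * (t ^ r + r * t) * (t ^ r) ^ 2 + 1) *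
      (Fintype.card V : ℝ) ^ (2 - 1 / (r : ℝ) - 1 / (4 * r) / (r * t ^ r)) := by
  set n : ℝ := (Fintype.card V : ℝ) with hn
  have hn1 : 1 ≤ n := by rw [hn]; exact_mod_cast Fintype.card_pos (α := V)
  have hn0 : 0 < n := by linarith
  have hr' : (1 : ℝ) ≤ r := by exact_mod_cast hr
  have ht' : (1 : ℝ) ≤ t := by exact_mod_cast ht
  set η : ℝ := 1 / (4 * r) with hη
  have hη1 : η ≤ 1 := by
    rw [hη, div_le_one (by positivity)]; linarith
  set δ : ℝ := η / (r * t ^ r) with hδ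
  have hδη : r * δ * t ^ r = η := by rw [hδ]; field_simp
  set T : ℝ := t ^ r + r * t with hT
  have hT1 : 1 ≤ T := by
    have : (1 : ℝ) ≤ t ^ r := one_le_pow₀ ht'
    have : 0 ≤ (r : ℝ) * t := by positivity
    linarith
  set K : ℝ := (r * t) ^ 2 + r * t * t ^ r + 2 * T * (t ^ r) ^ 2 with hK
  have hK0 : 0 ≤ K := by positivity
  set s := ∑ b ∈ B, (G.degree b : ℝ) with hs
  set S : ℝ := (#(lightTuples G t r B) : ℝ) with hS
  set m : ℝ := n ^ (2 - 1 / (r : ℝ) - δ) with hm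
  have hm0 : 0 < m := Real.rpow_pos_of_pos hn0 _
  have hsum : ∑ b ∈ B, (G.degree b : ℝ) ^ r ≤ 2 * T * S := by
    have := sum_degree_pow_le_card_lightTuples hG B hB
    rw [hT, hS]
    exact_mod_cast this
  have hpow : S ^ t ^ r * n ≤ K * n ^ (1 - η) * n ^ (r * t ^ r) := by
    have h := card_lightTuples_pow_le hG B ⌊n ^ (1 - η)⌋₊
      (Nat.le_floor (by simpa using Real.one_le_rpow hn1 (by linarith))) hB
      fun b hb => Nat.le_floor (hD b hb)
    have h' : S ^ t ^ r * n ≤ K * (⌊n ^ (1 - η)⌋₊ : ℝ) * n ^ (r * t ^ r) := by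
      rw [hS, hn, hK, hT]
      exact_mod_cast h
    refine h'.trans ?_
    gcongr
    exact Nat.floor_le (by positivity)
  have hmean : s ^ r * n ≤ n ^ r * (2 * T * S) := by
    -- Extending the degrees by zero outside `B` gives the power mean with `n` in place of `#B`.
    have h := sum_pow_mul_card_le (univ : Finset V) (fun b => if b ∈ B then (G.degree b : ℝ) else 0)
      (fun b _ => by split_ifs <;> positivity) r
    simp only [ite_pow, zero_pow (show r ≠ 0 by omega), sum_ite_mem, univ_inter, card_univ] at h
    exact h.trans (by gcongr)
  by_contra! hlt
  have hmr : m ^ r * n = n ^ r * n ^ (r - r * δ) := by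
    rw [hm, ← Real.rpow_mul_natCast hn0.le, ← Real.rpow_natCast n r, ← Real.rpow_add hn0,
      ← Real.rpow_add_one hn0.ne']
    congr 1
    field_simp
    ring
  -- The constant is `K + 1` so that the final comparison with the upper bound, whose constant is
  -- `K`, is strict.
  have hS' : (K + 1) * n ^ (r - r * δ) ≤ S := by
    have hC : 1 ≤ 2 * T * (K + 1) := by nlinarith
    refine le_of_mul_le_mul_left ?_ (show 0 < n ^ r * (2 * T) by positivity)
    calc n ^ r * (2 * T) * ((K + 1) * n ^ (r - r * δ))
        = 2 * T * (K + 1) * (m ^ r * n) := by rw [hmr]; ring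
      _ ≤ (2 * T * (K + 1)) ^ r * (m ^ r * n) := by
          gcongr
          exact le_self_pow₀ hC (by omega)
      _ = (2 * T * (K + 1) * m) ^ r * n := by rw [mul_pow _ m]; ring
      _ ≤ s ^ r * n := by gcongr
      _ ≤ n ^ r * (2 * T * S) := hmean
      _ = _ := by ring
  have hexp : (n ^ (r - r * δ)) ^ t ^ r * n = n ^ (1 - η) * n ^ (r * t ^ r) := by
    rw [← Real.rpow_mul_natCast hn0.le, ← Real.rpow_natCast n (r * t ^ r), ← Real.rpow_add hn0,
      ← Real.rpow_add_one hn0.ne']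
    congr 1
    push_cast
    rw [sub_mul, hδη]
    ring
  have hpos : 0 < n ^ (1 - η) * n ^ (r * t ^ r) := by positivity
  have hfin : (K + 1) * (n ^ (1 - η) * n ^ (r * t ^ r)) ≤ K * (n ^ (1 - η) * n ^ (r * t ^ r)) := by
    calc (K + 1) * (n ^ (1 - η) * n ^ (r * t ^ r))
        ≤ (K + 1) ^ t ^ r * (n ^ (1 - η) * n ^ (r * t ^ r)) := by
          gcongr
          exact le_self_pow₀ (by linarith) (pow_pos (by omega) r).ne'
      _ = ((K + 1) * n ^ (r - r * δ)) ^ t ^ r * n := by rw [← hexp, mul_pow]; ring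
      _ ≤ S ^ t ^ r * n := by gcongr
      _ ≤ _ := hpow
      _ = _ := by ring
  linarith

end Exponents

/-! ### The extremal bound. -/

theorem theorem6p2 (r t : ℕ) (hr : 2 ≤ r) (ht : 2 ≤ t) :
    ∃ C δ : ℝ, 0 < C ∧ 0 < δ ∧ ∀ n : ℕ,
      (SimpleGraph.extremalNumber n (Hypergraph.completeMultipartite r t).subdivision : ℝ) ≤
        C * (n : ℝ) ^ (2 - 1 / (r : ℝ) - δ) := by
  have hr' : (2 : ℝ) ≤ r := by exact_mod_cast hr
  have ht' : (2 : ℝ) ≤ t := by exact_mod_cast ht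
  set δ : ℝ := 1 / (4 * r) / (r * t ^ r) with hδ
  set M : ℝ := 2 ^ t ^ r * (r * t) ^ 2 with hM
  set T : ℝ := 2 * (t ^ r + r * t) with hT
  set C : ℝ := T * ((r * t) ^ 2 + r * t * t ^ r + T * (t ^ r) ^ 2 + 1) with hC
  -- This is where `r ≥ 2` is needed: the target exponent must absorb the high-degree bound.
  have hα : 5 / 4 ≤ 2 - 1 / (r : ℝ) - δ := by
    have h1 : 1 / (r : ℝ) ≤ 1 / 2 := one_div_le_one_div_of_le (by norm_num) hr'
    have h2 : 1 / (4 * r : ℝ) ≤ 1 / 4 := one_div_le_one_div_of_le (by norm_num) (by linarith)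
    have h3 : (1 : ℝ) ≤ r * t ^ r :=
      one_le_mul_of_one_le_of_one_le (by linarith) (one_le_pow₀ (by linarith))
    have h4 : δ ≤ 1 / (4 * r) := div_le_self (by positivity) h3
    linarith
  -- The summands pay for low, high and moderate degrees respectively.
  refine ⟨M + (T + C), δ, by positivity, by positivity, fun n => ?_⟩
  set α : ℝ := 2 - 1 / (r : ℝ) - δ with hα'
  classical
  have hnonneg : 0 ≤ (M + (T + C)) * (n : ℝ) ^ α := by positivity
  rw [← Fintype.card_fin n, SimpleGraph.extremalNumber_le_iff_of_nonneg _ (by simpa using hnonneg)]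
  intro G _ hG
  rw [Fintype.card_fin]
  have hdeg : ∑ b, (G.degree b : ℝ) = 2 * #G.edgeFinset := by
    exact_mod_cast G.sum_degrees_eq_twice_card_edges
  rcases n.eq_zero_or_pos with rfl | hn
  · simp only [univ_eq_empty, sum_empty] at hdeg
    linarith
  have : Nonempty (Fin n) := ⟨⟨0, hn⟩⟩
  have hn1 : (1 : ℝ) ≤ n := by exact_mod_cast hn
  have hpow : ∀ β ≤ α, (n : ℝ) ^ β ≤ (n : ℝ) ^ α := fun β hβ =>
    Real.rpow_le_rpow_of_exponent_le hn1 hβ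
  set p : Fin n → Prop := fun b => G.degree b ≤ 2 ^ t ^ r * (r * t) ^ 2
  set q : Fin n → Prop := fun b => (G.degree b : ℝ) ≤ (n : ℝ) ^ (1 - 1 / (4 * r : ℝ))
  have hsmall : ∑ b with p b, (G.degree b : ℝ) ≤ M * n ^ α := by
    calc ∑ b with p b, (G.degree b : ℝ) ≤ ∑ b with p b, M := by
          refine sum_le_sum fun b hb => ?_
          have := (mem_filter.1 hb).2
          rw [hM]
          exact_mod_cast this
      _ ≤ n * M := by
          rw [sum_const, nsmul_eq_mul]
          gcongr
          simpa using card_le_univ (filter p univ)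
      _ ≤ n ^ α * M := by
          gcongr
          simpa using hpow 1 (by linarith)
      _ = _ := mul_comm _ _
  have hlarge := sum_degree_le_of_large (by omega) hG {b ∈ {b | ¬ p b} | ¬ q b}
    (fun b hb => by simp only [mem_filter] at hb; exact not_le.1 hb.1.2)
    (fun b hb => by
      simp only [mem_filter] at hb
      rw [Fintype.card_fin]
      exact (not_le.1 hb.2).le)
  have hmoderate := sum_degree_le_of_moderate (by omega) (by omega) hG {b ∈ {b | ¬ p b} | q b}
    (fun b hb => by simp only [mem_filter] at hb; exact not_le.1 hb.1.2)
    (fun b hb => by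
      simp only [mem_filter] at hb
      rw [Fintype.card_fin]
      exact hb.2)
  rw [Fintype.card_fin, ← hT] at hlarge
  rw [Fintype.card_fin, ← hT, ← hC, ← hδ, ← hα'] at hmoderate
  have hlarge' := hlarge.trans (mul_le_mul_of_nonneg_left (hpow _ hα) (by positivity))
  have hsplit := sum_filter_add_sum_filter_not univ p fun b => (G.degree b : ℝ)
  rw [← sum_filter_add_sum_filter_not ({b | ¬ p b} : Finset (Fin n)) q, hdeg] at hsplit
  linarith
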